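/- Let $(X,d)$ be a complete metric space, let $h\colon[0,\infty)\to[0,\infty)$ be continuous and nondecreasing with $h(t)>0$ for all $t>0$, and let $\mu$ be a Borel probability measure on $X$ that is concentrated on its support, i.e. $\mu(\operatorname{supp}\mu)=1$ (automatic if $X$ is separable). For a probability measure $\nu$ on $X$ let $\Pi(\mu,\nu)$ be the set of transport plans, i.e. of probability measures on $X\times X$ with marginals $\mu$ and $\nu$. A plan $\lambda\in\Pi(\mu,\nu)$ is called $h\circ d$-optimal if it minimizes $C_h(\tilde\lambda)=\int h(d(x,y))\,d\tilde\lambda(x,y)\in[0,\infty]$ over $\tilde\lambda\in\Pi(\mu,\nu)$. For a function $\omega\colon[0,\infty)\to[0,\infty)$ put $\omega(\infty):=\sup_{t}\omega(t)$, and consider the property $$(\ast)_\omega\qquad \int h(d(x,y))\,d\lambda(x,y)\;\ge\;\omega\bigl(\lambda\text{-}\operatorname{ess\,sup}\,d\bigr)$$ for every Borel probability measure $\nu$ on $X$ with $\nu(\operatorname{supp}\mu)=1$ and every $h\circ d$-optimal $\lambda\in\Pi(\mu,\nu)$. If $h(0)=0$, then the following two conditions are equivalent. 1. $\operatorname{supp}\mu$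 is compact, and for all $x,y\in\operatorname{supp}\mu$ with $x\ne y$ there are $N\in\mathbb N$ and $z_0,\dots,z_{N+1}\in\operatorname{supp}\mu$ with $z_0=x$, $z_{N+1}=y$ and $\sum_{i=0}^{N}h(d(z_i,z_{i+1}))<h(d(x,y))$. 2. There is a nondecreasing $\omega\colon[0,\infty)\to[0,\infty)$ with $\omega(t)>0$ for all $t>0$ such that $(\ast)_\omega$ holds. Moreover, suppose that (1) holds (here $h(0)>0$ is allowed). Then there is a nondecreasing $\rho\colon[0,\infty)\to[0,\infty)$ with $\rho(0)=0$ and $\rho(t)>0$ for all $t>0$ such that $(\ast\ast)_\rho$: for all $x,y\in\operatorname{supp}\mu$ with $x\ne y$ there are $N\in\mathbb N$ and $z_0,\dots,z_{N+1}\in\operatorname{supp}\mu$ with $z_0=x$, $z_{N+1}=y$ and $\sum_{i=0}^{N}h\bigl(d(z_i,z_{i+1})+\rho(d(x,y))\bigr)<h(d(x,y))$. For every $\rho\colon[0,\infty)\to[0,\infty)$, nondecreasing or not, with $\rho(0)=0$, $\rho(t)>0$ for all $t>0$ and $(\ast\ast)_\rho$, the function $$\omega(t)=m\bigl(\rho(t)/4\bigr)\,h\bigl(\rho(t)/4\bigr),\qquad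 m(s):=\inf_{x\in\operatorname{supp}\mu}\mu(B(x,s)),\quad B(x,s)\text{ the open ball},$$ satisfies $(\ast)_\omega$ and $\omega(t)>0$ for all $t>0$, and $\omega$ is nondecreasing if $\rho$ is. -/

import Mathlib

open MeasureTheory
open scoped NNReal ENNReal

noncomputable section

namespace PlanEstimate

variable {X : Type*} [MetricSpace X] [MeasurableSpace X]

/-- `π` is a transport plan from `μ` to `ν`: its marginals are `μ` and `ν`. -/
def IsPlan (μ ν : Measure X) (π : Measure (X × X)) : Prop :=
  π.map Prod.fst = μ ∧ π.map Prod.snd = ν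

/-- The transport cost `C_h(π) = ∫ h(d(x,y)) dπ(x,y)`, with values in `[0,∞]`. -/
def cost (h : ℝ≥0 → ℝ≥0) (π : Measure (X × X)) : ℝ≥0∞ :=
  ∫⁻ p, (h (nndist p.1 p.2) : ℝ≥0∞) ∂π

/-- `π` minimizes `C_h` among all transport plans from `μ` to `ν`. -/
def IsOptimalPlan (h : ℝ≥0 → ℝ≥0) (μ ν : Measure X) (π : Measure (X × X)) : Prop :=
  IsPlan μ ν π ∧ ∀ π' : Measure (X × X), IsPlan μ ν π' → cost h π ≤ cost h π'

/-- The essential supremum of the distance with respect to `π`, with values in `[0,∞]`. -/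
def essDist (π : Measure (X × X)) : ℝ≥0∞ :=
  essSup (fun p : X × X => edist p.1 p.2) π

/-- The value of `ω : [0,∞) → [0,∞)` at `t ∈ [0,∞]`, with the convention `ω(∞) = sup ω`. -/
def extend (ω : ℝ≥0 → ℝ≥0) (t : ℝ≥0∞) : ℝ≥0∞ :=
  if t = ∞ then ⨆ s : ℝ≥0, (ω s : ℝ≥0∞) else (ω t.toNNReal : ℝ≥0∞)

/-- For every probability measure `ν` living on the support of `μ`, every optimal plan `π` from
`μ` to `ν` satisfies `∫ h(d(x,y)) dπ ≥ ω(π-ess sup d)`. -/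
def EstimateHolds (h : ℝ≥0 → ℝ≥0) (μ : Measure X) (ω : ℝ≥0 → ℝ≥0) : Prop :=
  ∀ ν : Measure X, IsProbabilityMeasure ν → ν μ.supportᶜ = 0 →
    ∀ π : Measure (X × X), IsOptimalPlan h μ ν π → extend ω (essDist π) ≤ cost h π

/-- `m(t)`, the infimum over `x ∈ supp μ` of `μ(B(x,t))`, where the balls are open. -/
def minBall (μ : Measure X) (t : ℝ≥0) : ℝ≥0 :=
  (⨅ x ∈ μ.support, μ (Metric.ball x t)).toNNReal

/-- Any two distinct points `x, y ∈ S` are joined by a chain `x = z_0, …, z_{N+1} = y` in `S`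
with `∑ h(d(z_i, z_{i+1})) < h(d(x,y))`. -/
def StrictlyCyclicallyConvex (h : ℝ≥0 → ℝ≥0) (S : Set X) : Prop :=
  ∀ x ∈ S, ∀ y ∈ S, x ≠ y → ∃ (N : ℕ) (z : ℕ → X),
    (∀ i ≤ N + 1, z i ∈ S) ∧ z 0 = x ∧ z (N + 1) = y ∧
    ∑ i ∈ Finset.range (N + 1), h (nndist (z i) (z (i + 1))) < h (nndist x y)

/-- The uniform version of the chain condition, with the gain `ρ(d(x,y))` in each step. -/
def UniformlyCyclicallyConvex (h ρ : ℝ≥0 → ℝ≥0) (S : Set X) : Prop :=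
  ∀ x ∈ S, ∀ y ∈ S, x ≠ y → ∃ (N : ℕ) (z : ℕ → X),
    (∀ i ≤ N + 1, z i ∈ S) ∧ z 0 = x ∧ z (N + 1) = y ∧
    ∑ i ∈ Finset.range (N + 1), h (nndist (z i) (z (i + 1)) + ρ (nndist x y)) < h (nndist x y)

/-- The support of `μ` is compact and strictly `h ∘ d`-cyclically convex. -/
def SupportCondition (h : ℝ≥0 → ℝ≥0) (μ : Measure X) : Prop :=
  IsCompact μ.support ∧ StrictlyCyclicallyConvex h μ.support

/-- `ω` is nondecreasing and positive on `(0,∞)`. -/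
def IsModulus (ω : ℝ≥0 → ℝ≥0) : Prop :=
  Monotone ω ∧ ∀ t, 0 < t → 0 < ω t

/-- Optimal plans starting from `μ` satisfy the `L^∞` estimate with some modulus `ω`. -/
def PlanCondition (h : ℝ≥0 → ℝ≥0) (μ : Measure X) : Prop :=
  ∃ ω : ℝ≥0 → ℝ≥0, IsModulus ω ∧ EstimateHolds h μ ω

/-- The explicit function `t ↦ m(ρ(t)/4) h(ρ(t)/4)`. -/
def explicitModulus (h : ℝ≥0 → ℝ≥0) (μ : Measure X) (ρ : ℝ≥0 → ℝ≥0) (t : ℝ≥0) : ℝ≥0 :=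
  minBall μ (ρ t / 4) * h (ρ t / 4)

end PlanEstimate

end

open scoped Topology
open Set Filter

noncomputable section

/-! From the support condition to the estimate. By compactness the gain of a shortcut can be chosen
uniformly over all pairs at distance at least `t`. Let `π` be optimal with cost below `m(r/4)
h(r/4)`, where `r = ρ(d(x,y))` and `(x,y)` is a point of the support of `π` at which the essential
supremum is attained. By Markov's inequality some mass near every point of `supp μ` moves by less
than `r/4`. Inserting such short transports along a shortcut from `x` to `y` and shifting all
targets cyclically by one place lowers the cost, against optimality (`IsOptimalPlan.sum_le_sum`,
`estimateHolds_explicitModulus`).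

From the estimate to the support condition. The estimate is tested on plans that move part of `μ` to
one point `y` of the support and leave the rest in place. If `F u ≤ F v + h(d(u,v))`, then moving
the points with `h(d(u,y)) ≤ F u + s` is optimal, as explicit dual potentials show; on ties one may
move as little as one likes. With `F = 0` and `s` the level at which mass at distance `t` starts to
move, this gives `ω(t) ≤ h(t) μ(B(y,t))`. So balls have uniformly positive mass, and the support is
totally bounded, hence compact. With `F` the truncated infimal chain cost to `y`, a pair `(x,y)`
without shortcut makes `x` a tie at level `0`: mass near `x` must move at every positive level,
while the mass moved at level `0` costs nothing, which contradicts `ω > 0`. -/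

namespace PlanEstimate

/-! ### Uniform gain of shortcuts on a compact set -/

section Moduli

variable {X : Type*} [MetricSpace X]

/-- `x` and `y` are joined by a chain in `S` that is cheaper than `h (d(x,y))`, even when every
step is lengthened by `r`. -/
def HasShortcut (h : ℝ≥0 → ℝ≥0) (S : Set X) (r : ℝ≥0) (x y : X) : Prop :=
  ∃ (N : ℕ) (z : ℕ → X), (∀ i ≤ N + 1, z i ∈ S) ∧ z 0 = x ∧ z (N + 1) = y ∧
    ∑ i ∈ Finset.range (N + 1), h (nndist (z i) (z (i + 1)) + r) < h (nndist x y)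

theorem HasShortcut.anti {h : ℝ≥0 → ℝ≥0} (h_mono : Monotone h) {S : Set X} {r r' : ℝ≥0} {x y : X}
    (hr : r' ≤ r) (H : HasShortcut h S r x y) : HasShortcut h S r' x y := by
  obtain ⟨N, z, h1, h2, h3, h4⟩ := H
  exact ⟨N, z, h1, h2, h3, lt_of_le_of_lt
    (Finset.sum_le_sum fun i _ => h_mono (by gcongr)) h4⟩

/-- A shortcut persists, with a positive gain, for all nearby pairs of points. -/
theorem HasShortcut.eventually {h : ℝ≥0 → ℝ≥0} (h_cont : Continuous h) {S : Set X} {x y : X}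
    (H : HasShortcut h S 0 x y) :
    ∃ r : ℝ≥0, 0 < r ∧ ∃ U ∈ 𝓝 (x, y), ∀ p ∈ U, p.1 ∈ S → p.2 ∈ S → HasShortcut h S r p.1 p.2 := by
  obtain ⟨N, z, h1, h2, h3, h4⟩ := H
  -- Only the endpoints move. The strict inequality is then an open condition on the pair and the
  -- gain jointly.
  let w : X × X → ℕ → X := fun p => Function.update (Function.update z 0 p.1) (N + 1) p.2
  have hw : ∀ i, Continuous fun p => w p i := by
    intro i
    by_cases hi : i = N + 1
    · subst hi; simpa [w] using continuous_snd
    · by_cases hi0 : i = 0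
      · subst hi0; simpa [w, Function.update_of_ne hi] using continuous_fst
      · simpa [w, Function.update_of_ne hi, Function.update_of_ne hi0] using continuous_const
  have hw0 : w (x, y) = z := by
    funext i
    by_cases hi : i = N + 1
    · subst hi; simp [w, h3]
    · by_cases hi0 : i = 0
      · subst hi0; simp [w, h2]
      · simp [w, Function.update_of_ne hi, Function.update_of_ne hi0]
  have c1 : Continuous fun q : (X × X) × ℝ≥0 =>
      ∑ i ∈ Finset.range (N + 1), h (nndist (w q.1 i) (w q.1 (i + 1)) + q.2) := by
    refine continuous_finsetSum _ fun i _ => h_cont.comp ?_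
    exact (((hw i).comp continuous_fst).nndist ((hw (i + 1)).comp continuous_fst)).add
      continuous_snd
  have c2 : Continuous fun q : (X × X) × ℝ≥0 => h (nndist q.1.1 q.1.2) := by fun_prop
  have ho := isOpen_lt c1 c2
  have hm : ((x, y), (0 : ℝ≥0)) ∈ {q : (X × X) × ℝ≥0 |
      ∑ i ∈ Finset.range (N + 1), h (nndist (w q.1 i) (w q.1 (i + 1)) + q.2)
        < h (nndist q.1.1 q.1.2)} := by
    simpa [hw0] using h4
  obtain ⟨U, hU, V, hV, hUV⟩ := mem_nhds_prod_iff.1 (ho.mem_nhds hm)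
  obtain ⟨r, hr, hrV⟩ : ∃ r : ℝ≥0, 0 < r ∧ r ∈ V := by
    obtain ⟨r, hrV, hr⟩ := Filter.nonempty_of_mem
      (inter_mem (nhdsWithin_le_nhds hV : V ∈ 𝓝[>] (0 : ℝ≥0)) self_mem_nhdsWithin)
    exact ⟨r, hr, hrV⟩
  refine ⟨r, hr, U, hU, fun p hp hp1 hp2 => ⟨N, w p, ?_, ?_, ?_, ?_⟩⟩
  · intro i hi
    by_cases hi : i = N + 1
    · subst hi; simpa [w] using hp2
    · by_cases hi0 : i = 0
      · subst hi0; simpa [w, Function.update_of_ne hi] using hp1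
      · simpa [w, Function.update_of_ne hi, Function.update_of_ne hi0] using h1 i (by omega)
  · simp [w]
  · simp [w]
  · exact hUV (mk_mem_prod hp hrV)

/-- On a compact set the gain of the shortcuts is bounded below at distances at least `t`. -/
theorem exists_uniform_gain {h : ℝ≥0 → ℝ≥0} (h_mono : Monotone h) (h_cont : Continuous h)
    {S : Set X} (hS : IsCompact S) (hc : StrictlyCyclicallyConvex h S) {t : ℝ≥0} (ht : 0 < t) :
    ∃ r : ℝ≥0, 0 < r ∧ ∀ x ∈ S, ∀ y ∈ S, t ≤ nndist x y → HasShortcut h S r x y := by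
  have hK : IsCompact ((S ×ˢ S) ∩ {p : X × X | t ≤ nndist p.1 p.2}) :=
    (hS.prod hS).inter_right (isClosed_le continuous_const continuous_nndist)
  have := hK.induction_on (p := fun s => ∃ r : ℝ≥0, 0 < r ∧
      ∀ p ∈ s, p.1 ∈ S → p.2 ∈ S → HasShortcut h S r p.1 p.2) ⟨1, one_pos, by simp⟩ ?_ ?_ ?_
  · obtain ⟨r, hr, H⟩ := this
    exact ⟨r, hr, fun x hx y hy hxy => H (x, y) ⟨⟨hx, hy⟩, hxy⟩ hx hy⟩
  · rintro s s' hss ⟨r, hr, H⟩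
    exact ⟨r, hr, fun p hp => H p (hss hp)⟩
  · rintro s s' ⟨r, hr, H⟩ ⟨r', hr', H'⟩
    refine ⟨min r r', lt_min hr hr', ?_⟩
    rintro p (hp | hp) h1 h2
    · exact (H p hp h1 h2).anti h_mono (min_le_left _ _)
    · exact (H' p hp h1 h2).anti h_mono (min_le_right _ _)
  · rintro ⟨x, y⟩ ⟨⟨hx, hy⟩, hxy⟩
    have hne : x ≠ y := by
      rintro rfl
      simp only [mem_ofPred_eq, nndist_self] at hxy
      exact absurd hxy (not_le.2 ht)
    have h0 : HasShortcut h S 0 x y := by simpa [HasShortcut] using hc x hx y hy hne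
    obtain ⟨r, hr, U, hU, H⟩ := h0.eventually h_cont
    exact ⟨U, mem_nhdsWithin_of_mem_nhds hU, r, hr, H⟩

theorem exists_uniformlyCyclicallyConvex {h : ℝ≥0 → ℝ≥0} (h_mono : Monotone h)
    (h_cont : Continuous h) {S : Set X} (hS : IsCompact S) (hc : StrictlyCyclicallyConvex h S) :
    ∃ ρ : ℝ≥0 → ℝ≥0, ρ 0 = 0 ∧ IsModulus ρ ∧ UniformlyCyclicallyConvex h ρ S := by
  -- Gains valid at all distances at least `t`, so that `G` grows with `t`. The cap `1` keeps `G t`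
  -- bounded when no pair is that far apart.
  let G : ℝ≥0 → Set ℝ≥0 := fun t =>
    {r | r ≤ 1 ∧ ∀ x ∈ S, ∀ y ∈ S, t ≤ nndist x y → x ≠ y → HasShortcut h S r x y}
  have hG : ∀ t, BddAbove (G t) := fun t => ⟨1, fun r hr => hr.1⟩
  have hpos : ∀ t, 0 < t → ∃ r ∈ G t, 0 < r := by
    intro t ht
    obtain ⟨r, hr, H⟩ := exists_uniform_gain h_mono h_cont hS hc ht
    exact ⟨min r 1, ⟨min_le_right _ _, fun x hx y hy hxy _ =>
      (H x hx y hy hxy).anti h_mono (min_le_left _ _)⟩, lt_min hr one_pos⟩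
  have hs : ∀ t, 0 < t → 0 < sSup (G t) := by
    intro t ht
    obtain ⟨r, hr, hr0⟩ := hpos t ht
    exact hr0.trans_le (le_csSup (hG t) hr)
  -- The supremum need not be attained; half of it lies below some admissible gain, and smaller
  -- gains stay admissible.
  refine ⟨fun t => if t = 0 then 0 else sSup (G t) / 2, by simp, ⟨?_, ?_⟩, ?_⟩
  · intro s t hst
    dsimp only
    by_cases hs0 : s = 0
    · simp [hs0]
    · have hs' : 0 < s := pos_iff_ne_zero.2 hs0
      have ht : t ≠ 0 := (hs'.trans_le hst).ne'
      rw [if_neg hs0, if_neg ht]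
      obtain ⟨r, hr, -⟩ := hpos s hs'
      refine div_le_div_of_nonneg_right ?_ zero_le_two
      exact csSup_le_csSup (hG t) ⟨r, hr⟩
        fun r hr => ⟨hr.1, fun x hx y hy hxy => hr.2 x hx y hy (hst.trans hxy)⟩
  · intro t ht
    simp only [if_neg ht.ne']
    exact half_pos (hs t ht)
  · intro x hx y hy hne
    have ht : 0 < nndist x y := pos_iff_ne_zero.2 (by simpa using hne)
    simp only [if_neg ht.ne']
    obtain ⟨r, hr, hr0⟩ := hpos _ ht
    obtain ⟨r', hr', hlt⟩ := exists_lt_of_lt_csSup ⟨r, hr⟩ (half_lt_self (hs _ ht))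
    exact (hr'.2 x hx y hy le_rfl hne).anti h_mono hlt.le

end Moduli

/-! ### Minimal mass of balls centred in the support -/

section MinBall

variable {X : Type*} [MetricSpace X] [MeasurableSpace X]

theorem support_nonempty {μ : Measure X} [IsProbabilityMeasure μ] (hμ : μ μ.supportᶜ = 0) :
    μ.support.Nonempty := by
  by_contra hne
  simp [not_nonempty_iff_eq_empty.1 hne] at hμ

theorem coe_minBall {μ : Measure X} [IsProbabilityMeasure μ] (hμ : μ μ.supportᶜ = 0) (t : ℝ≥0) :
    (minBall μ t : ℝ≥0∞) = ⨅ x ∈ μ.support, μ (Metric.ball x t) := by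
  obtain ⟨x, hx⟩ := support_nonempty hμ
  exact ENNReal.coe_toNNReal ((iInf₂_le x hx).trans_lt (measure_lt_top μ _)).ne

theorem minBall_le {μ : Measure X} [IsProbabilityMeasure μ] (hμ : μ μ.supportᶜ = 0) {x : X}
    (hx : x ∈ μ.support) (t : ℝ≥0) : (minBall μ t : ℝ≥0∞) ≤ μ (Metric.ball x t) := by
  rw [coe_minBall hμ]; exact iInf₂_le x hx

theorem minBall_zero {μ : Measure X} [IsProbabilityMeasure μ] (hμ : μ μ.supportᶜ = 0) :
    minBall μ 0 = 0 := by
  obtain ⟨x, hx⟩ := support_nonempty hμ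
  simpa using minBall_le hμ hx 0

theorem minBall_mono {μ : Measure X} [IsProbabilityMeasure μ] (hμ : μ μ.supportᶜ = 0) :
    Monotone (minBall μ) := by
  intro s t hst
  rw [← ENNReal.coe_le_coe, coe_minBall hμ, coe_minBall hμ]
  exact iInf₂_mono fun x _ => measure_mono (Metric.ball_subset_ball (by exact_mod_cast hst))

/-- For `y` within `t/2` of `x`, the ball `B(y,t)` contains `B(x,t/2)`, which has positive mass.
This local lower bound becomes uniform by compactness. -/
theorem minBall_pos {μ : Measure X} [IsProbabilityMeasure μ] (hμ : μ μ.supportᶜ = 0)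
    (hS : IsCompact μ.support) {t : ℝ≥0} (ht : 0 < t) : 0 < minBall μ t := by
  rw [← ENNReal.coe_pos, coe_minBall hμ]
  have := hS.induction_on (p := fun s => ∃ r : ℝ≥0∞, 0 < r ∧ ∀ x ∈ s, r ≤ μ (Metric.ball x t))
    ⟨1, one_pos, by simp⟩ ?_ ?_ ?_
  · obtain ⟨r, hr, H⟩ := this
    exact hr.trans_le (le_iInf₂ H)
  · rintro s s' hss ⟨r, hr, H⟩
    exact ⟨r, hr, fun p hp => H p (hss hp)⟩
  · rintro s s' ⟨r, hr, H⟩ ⟨r', hr', H'⟩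
    refine ⟨min r r', lt_min hr hr', ?_⟩
    rintro p (hp | hp)
    · exact (min_le_left _ _).trans (H p hp)
    · exact (min_le_right _ _).trans (H' p hp)
  · intro x hx
    have ht2 : (0 : ℝ) < t / 2 := by positivity
    refine ⟨_, mem_nhdsWithin_of_mem_nhds (Metric.ball_mem_nhds x ht2), μ (Metric.ball x (t / 2)),
      (Measure.mem_support_iff_forall x).1 hx _ (Metric.ball_mem_nhds x ht2), ?_⟩
    intro y hy
    refine measure_mono fun z hz => ?_
    rw [Metric.mem_ball] at *
    have := dist_triangle_right z y x
    linarith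

end MinBall

/-! ### Marginals of plans -/

section Plan

variable {X : Type*} [MeasurableSpace X]

theorem IsPlan.isProbabilityMeasure {μ ν : Measure X} [IsProbabilityMeasure μ]
    {π : Measure (X × X)} (hπ : IsPlan μ ν π) : IsProbabilityMeasure π := by
  constructor
  rw [← preimage_univ (f := Prod.fst), ← Measure.map_apply measurable_fst .univ, hπ.1, measure_univ]

theorem IsPlan.ae_fst {μ ν : Measure X} {π : Measure (X × X)} (hπ : IsPlan μ ν π) {p : X → Prop}
    (hp : ∀ᵐ x ∂μ, p x) : ∀ᵐ q ∂π, p q.1 :=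
  ae_of_ae_map measurable_fst.aemeasurable (by rwa [hπ.1])

theorem IsPlan.ae_snd {μ ν : Measure X} {π : Measure (X × X)} (hπ : IsPlan μ ν π) {p : X → Prop}
    (hp : ∀ᵐ x ∂ν, p x) : ∀ᵐ q ∂π, p q.2 :=
  ae_of_ae_map measurable_snd.aemeasurable (by rwa [hπ.2])

end Plan

/-! ### Cyclical monotonicity and the essential supremum -/

section Optimal

variable {X : Type*} [MetricSpace X] [MeasurableSpace X]

/-- Although the distance need not be measurable for the product σ-algebra, it is almost everywhere
measurable for measures living on the square of a separable set. -/
theorem aemeasurable_edist [BorelSpace X] {S : Set X} (hS : TopologicalSpace.IsSeparable S)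
    {π : Measure (X × X)} (h1 : ∀ᵐ q ∂π, q.1 ∈ S) :
    AEMeasurable (fun p : X × X => edist p.1 p.2) π := by
  obtain ⟨c, hc, hSc⟩ := hS
  -- Going through a countable set whose closure contains `S` splits the distance into functions of
  -- one variable each, which are measurable for the product σ-algebra.
  refine ⟨fun p => ⨅ s ∈ c, edist p.1 s + edist s p.2, ?_, ?_⟩
  · refine Measurable.biInf c hc fun s _ => ?_
    have e1 : Measurable fun x : X => edist x s := (continuous_id.edist continuous_const).measurable
    have e2 : Measurable fun x : X => edist s x := (continuous_const.edist continuous_id).measurable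
    exact (e1.comp measurable_fst).add (e2.comp measurable_snd)
  · filter_upwards [h1] with q hq
    refine le_antisymm (le_iInf₂ fun s _ => edist_triangle _ _ _) ?_
    refine ENNReal.le_of_forall_pos_le_add fun ε hε _ => ?_
    obtain ⟨s, hs, hqs⟩ := EMetric.mem_closure_iff.1 (hSc hq) (ε / 2 : ℝ≥0)
      (by exact_mod_cast half_pos hε)
    calc ⨅ s ∈ c, edist q.1 s + edist s q.2 ≤ edist q.1 s + edist s q.2 := iInf₂_le s hs
      _ ≤ edist q.1 s + (edist s q.1 + edist q.1 q.2) := by gcongr; exact edist_triangle _ _ _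
      _ ≤ (ε / 2 : ℝ≥0) + ((ε / 2 : ℝ≥0) + edist q.1 q.2) := by
          gcongr
          rw [edist_comm]; exact hqs.le
      _ = edist q.1 q.2 + ε := by
          rw [← add_assoc, ← ENNReal.coe_add, add_halves, add_comm]

theorem cost_add (h : ℝ≥0 → ℝ≥0) (π π' : Measure (X × X)) :
    cost h (π + π') = cost h π + cost h π' := lintegral_add_measure _ _ _

theorem cost_smul (h : ℝ≥0 → ℝ≥0) (c : ℝ≥0∞) (π : Measure (X × X)) :
    cost h (c • π) = c * cost h π := lintegral_smul_measure _ _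

theorem cost_sum (h : ℝ≥0 → ℝ≥0) {ι : Type*} (s : Finset ι) (π : ι → Measure (X × X)) :
    cost h (∑ i ∈ s, π i) = ∑ i ∈ s, cost h (π i) := lintegral_finsetSum_measure _ _ _

/-- A part of an optimal plan of finite cost cannot be replaced by something cheaper with the same
marginals. -/
theorem IsOptimalPlan.cost_le_of_le {h : ℝ≥0 → ℝ≥0} {μ ν : Measure X} {π : Measure (X × X)}
    [IsFiniteMeasure π] (hπ : IsOptimalPlan h μ ν π) (hfin : cost h π ≠ ∞)
    {σ σ' : Measure (X × X)} (hσ : σ ≤ π) (h1 : σ'.map Prod.fst = σ.map Prod.fst)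
    (h2 : σ'.map Prod.snd = σ.map Prod.snd) : cost h σ ≤ cost h σ' := by
  have : IsFiniteMeasure σ := isFiniteMeasure_of_le π hσ
  have hsub : π - σ + σ = π := Measure.sub_add_cancel_of_le hσ
  have hplan : IsPlan μ ν (π - σ + σ') := by
    constructor
    · rw [Measure.map_add _ _ measurable_fst, h1, ← Measure.map_add _ _ measurable_fst, hsub,
        hπ.1.1]
    · rw [Measure.map_add _ _ measurable_snd, h2, ← Measure.map_add _ _ measurable_snd, hsub,
        hπ.1.2]
  have hle := hπ.2 _ hplan
  have hsplit : cost h π = cost h (π - σ) + cost h σ := by rw [← cost_add, hsub]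
  rw [hsplit, cost_add] at hle
  refine (ENNReal.add_le_add_iff_left ?_).1 hle
  intro htop
  exact hfin (by rw [hsplit, htop, top_add])

theorem map_finsetSum {α β ι : Type*} [MeasurableSpace α] [MeasurableSpace β] {f : α → β}
    (hf : Measurable f) (s : Finset ι) (m : ι → Measure α) :
    (∑ i ∈ s, m i).map f = ∑ i ∈ s, (m i).map f := by
  simp only [← Measure.mapₗ_apply_of_measurable hf, map_sum]

/-- Cyclical monotonicity of an optimal plan on rectangles of positive measure. -/
theorem IsOptimalPlan.sum_le_sum {h : ℝ≥0 → ℝ≥0} {μ ν : Measure X} {π : Measure (X × X)}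
    [IsProbabilityMeasure π] (hπ : IsOptimalPlan h μ ν π) (hfin : cost h π ≠ ∞)
    {ι : Type*} [Fintype ι] [Nonempty ι] (τ : Equiv.Perm ι) {U V : ι → Set X}
    (hU : ∀ i, MeasurableSet (U i)) (hV : ∀ i, MeasurableSet (V i))
    (hpos : ∀ i, 0 < π (U i ×ˢ V i)) {a b : ι → ℝ≥0}
    (ha : ∀ i, ∀ u ∈ U i, ∀ v ∈ V i, a i ≤ h (nndist u v))
    (hb : ∀ i, ∀ u ∈ U i, ∀ v ∈ V (τ i), h (nndist u v) ≤ b i) : ∑ i, a i ≤ ∑ i, b i := by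
  obtain ⟨i₀, hi₀⟩ := Finite.exists_min fun i => π (U i ×ˢ V i)
  let κ : ι → Measure (X × X) := fun i => ProbabilityTheory.cond π (U i ×ˢ V i)
  have hκ : ∀ i, IsProbabilityMeasure (κ i) :=
    fun i => ProbabilityTheory.cond_isProbabilityMeasure (hpos i).ne'
  have hκ1 : ∀ i, IsProbabilityMeasure ((κ i).map Prod.fst) :=
    fun i => Measure.isProbabilityMeasure_map measurable_fst.aemeasurable
  have hκ2 : ∀ i, IsProbabilityMeasure ((κ i).map Prod.snd) :=
    fun i => Measure.isProbabilityMeasure_map measurable_snd.aemeasurable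
  have hmem : ∀ i, ∀ᵐ q ∂(κ i), q ∈ U i ×ˢ V i :=
    fun i => ProbabilityTheory.ae_cond_mem ((hU i).prod (hV i))
  have hmem1 : ∀ i, ∀ᵐ x ∂((κ i).map Prod.fst), x ∈ U i := fun i => by
    refine (ae_map_iff measurable_fst.aemeasurable (p := fun x => x ∈ U i) (hU i)).2 ?_
    filter_upwards [hmem i] with q hq using hq.1
  have hmem2 : ∀ i, ∀ᵐ x ∂((κ i).map Prod.snd), x ∈ V i := fun i => by
    refine (ae_map_iff measurable_snd.aemeasurable (p := fun x => x ∈ V i) (hV i)).2 ?_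
    filter_upwards [hmem i] with q hq using hq.2
  set m : ℝ≥0∞ := π (U i₀ ×ˢ V i₀) with hm
  set n : ℝ≥0∞ := ((Fintype.card ι : ℕ) : ℝ≥0∞) with hn
  have hn0 : n ≠ 0 := by simp [hn]
  have hnt : n ≠ ∞ := by simp [hn]
  -- With `m` the least mass of the `n` rectangles, each `e • κ i` is at most `π / n`. So their sum
  -- fits under `π` even if the rectangles overlap.
  set e : ℝ≥0∞ := n⁻¹ * m with he
  have he0 : e ≠ 0 := mul_ne_zero (ENNReal.inv_ne_zero.2 hnt) (hpos i₀).ne'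
  have het : e ≠ ∞ := ENNReal.mul_ne_top (ENNReal.inv_ne_top.2 hn0) (measure_ne_top π _)
  have hle : ∑ i, e • κ i ≤ π := by
    have hi : ∀ i, e • κ i ≤ n⁻¹ • π := by
      intro i
      rw [he, mul_smul]
      refine Measure.le_iff.2 fun s _ => ?_
      simp only [κ, ProbabilityTheory.cond, Measure.smul_apply, smul_eq_mul]
      gcongr
      rw [← mul_assoc]
      calc m * (π (U i ×ˢ V i))⁻¹ * (π.restrict (U i ×ˢ V i)) s
          ≤ 1 * π s := by
            gcongr
            · rw [← div_eq_mul_inv]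
              exact ENNReal.div_le_of_le_mul (by simpa using hi₀ i)
            · exact Measure.restrict_le_self
        _ = π s := one_mul _
    calc ∑ i, e • κ i ≤ ∑ _i : ι, n⁻¹ • π := Finset.sum_le_sum fun i _ => hi i
      _ = π := by
        rw [Finset.sum_const, Finset.card_univ, ← Nat.cast_smul_eq_nsmul ℝ≥0∞, ← mul_smul,
          ENNReal.mul_inv_cancel hn0 hnt, one_smul]
  -- Sources from rectangle `i` are recoupled independently with targets from rectangle `τ i`. The
  -- total marginals survive because `τ` only permutes the summands.
  have key := hπ.cost_le_of_le hfin hle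
    (σ' := ∑ i, e • ((κ i).map Prod.fst).prod ((κ (τ i)).map Prod.snd)) ?_ ?_
  · rw [cost_sum, cost_sum] at key
    simp only [cost_smul] at key
    rw [← Finset.mul_sum, ← Finset.mul_sum, ENNReal.mul_le_mul_iff_right he0 het] at key
    have h1 : (∑ i, (a i : ℝ≥0∞)) ≤ ∑ i, cost h (κ i) := by
      refine Finset.sum_le_sum fun i _ => ?_
      calc (a i : ℝ≥0∞) = ∫⁻ _, (a i : ℝ≥0∞) ∂(κ i) := by simp
        _ ≤ cost h (κ i) := by
          refine lintegral_mono_ae ?_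
          filter_upwards [hmem i] with q hq
          exact_mod_cast ha i _ hq.1 _ hq.2
    have h2 : ∑ i, cost h (((κ i).map Prod.fst).prod ((κ (τ i)).map Prod.snd))
        ≤ ∑ i, (b i : ℝ≥0∞) := by
      refine Finset.sum_le_sum fun i _ => ?_
      calc cost h (((κ i).map Prod.fst).prod ((κ (τ i)).map Prod.snd))
          ≤ ∫⁻ _, (b i : ℝ≥0∞) ∂(((κ i).map Prod.fst).prod ((κ (τ i)).map Prod.snd)) := by
            refine lintegral_mono_ae ?_
            filter_upwards [Measure.quasiMeasurePreserving_fst.ae (hmem1 i),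
              Measure.quasiMeasurePreserving_snd.ae (hmem2 (τ i))] with q hq1 hq2
            exact_mod_cast hb i _ hq1 _ hq2
        _ = b i := by simp
    exact_mod_cast h1.trans (key.trans h2)
  · simp only [map_finsetSum measurable_fst, Measure.map_smul, Measure.map_fst_prod, measure_univ,
      one_smul]
  · simp only [map_finsetSum measurable_snd, Measure.map_smul, Measure.map_snd_prod, measure_univ,
      one_smul]
    exact Equiv.sum_comp τ fun i => e • (κ i).map Prod.snd

/-- The essential supremum of the distance is attained at a point of the support. -/
theorem exists_nndist_eq_essDist {S : Set X} (hS : IsCompact S) {π : Measure (X × X)}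
    (hmem : ∀ᵐ q ∂π, q.1 ∈ S ∧ q.2 ∈ S) (hpos : 0 < essDist π) :
    ∃ x ∈ S, ∃ y ∈ S, edist x y = essDist π ∧ ∀ U ∈ 𝓝 (x, y), 0 < π U := by
  have hce : Continuous fun q : X × X => edist q.1 q.2 := continuous_fst.edist continuous_snd
  have hae : ∀ᵐ q ∂π, edist q.1 q.2 ≤ essDist π := ENNReal.ae_le_essSup _
  by_contra! hcon
  have hnull : ∀ q : X × X, q.1 ∈ S → q.2 ∈ S → essDist π ≤ edist q.1 q.2 →
      ∃ U ∈ 𝓝 q, π U = 0 := by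
    rintro ⟨x, y⟩ hx hy hxy
    rcases hxy.eq_or_lt with heq | hlt
    · obtain ⟨U, hU, hU0⟩ := hcon x hx y hy heq.symm
      exact ⟨U, hU, le_antisymm hU0 zero_le⟩
    · refine ⟨_, (isOpen_lt continuous_const hce).mem_nhds hlt, ?_⟩
      simpa [ae_iff] using hae
  -- If the claim fails, every pair in `S × S` has a neighbourhood on which the distance is a.e.
  -- bounded by some `r < essDist π`. Compactness yields one such `r` for all of `S × S`, which is
  -- absurd.
  have := (hS.prod hS).induction_on (p := fun s => ∃ r < essDist π,
      ∀ᵐ q ∂π, q ∈ s → edist q.1 q.2 ≤ r) ⟨0, hpos, by simp⟩ ?_ ?_ ?_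
  · obtain ⟨r, hr, H⟩ := this
    refine hr.not_ge (essSup_le_of_ae_le r ?_)
    filter_upwards [H, hmem] with q hq hq' using hq hq'
  · rintro s s' hss ⟨r, hr, H⟩
    exact ⟨r, hr, H.mono fun q hq hqs => hq (hss hqs)⟩
  · rintro s s' ⟨r, hr, H⟩ ⟨r', hr', H'⟩
    refine ⟨max r r', max_lt hr hr', ?_⟩
    filter_upwards [H, H'] with q hq hq'
    rintro (h | h)
    · exact (hq h).trans (le_max_left _ _)
    · exact (hq' h).trans (le_max_right _ _)
  · rintro q ⟨hq1, hq2⟩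
    rcases lt_or_ge (edist q.1 q.2) (essDist π) with hlt | hge
    · obtain ⟨r, hr1, hr2⟩ := exists_between hlt
      exact ⟨_, mem_nhdsWithin_of_mem_nhds ((isOpen_lt hce continuous_const).mem_nhds hr1), r, hr2,
        ae_of_all _ fun p hp => le_of_lt hp⟩
    · obtain ⟨U, hU, hU0⟩ := hnull q hq1 hq2 hge
      refine ⟨U, mem_nhdsWithin_of_mem_nhds hU, 0, hpos, ?_⟩
      filter_upwards [measure_eq_zero_iff_ae_notMem.1 hU0] with p hp hpU using absurd hpU hp

end Optimal

/-! ### The explicit modulus satisfies the estimate -/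

section Estimate

variable {X : Type*} [MetricSpace X] [MeasurableSpace X] [BorelSpace X]

theorem aemeasurable_cost {h : ℝ≥0 → ℝ≥0} (h_cont : Continuous h) {S : Set X}
    (hS : TopologicalSpace.IsSeparable S) {π : Measure (X × X)} (h1 : ∀ᵐ q ∂π, q.1 ∈ S) :
    AEMeasurable (fun p : X × X => (h (nndist p.1 p.2) : ℝ≥0∞)) π := by
  have := (aemeasurable_edist hS h1).ennreal_toNNReal
  simp only [edist_nndist, ENNReal.toNNReal_coe] at this
  exact (h_cont.measurable.comp_aemeasurable this).coe_nnreal_ennreal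

/-- If the cost of a plan is less than `m(s) h(s)`, then in the ball `B(z,s)` around every point `z`
of the support some mass is moved by less than `s`. -/
theorem measure_ball_prod_pos {h : ℝ≥0 → ℝ≥0} (h_mono : Monotone h) (h_cont : Continuous h)
    {μ ν : Measure X} [IsProbabilityMeasure μ] (hμ : μ μ.supportᶜ = 0)
    (hS : IsCompact μ.support) {π : Measure (X × X)} (hπ : IsPlan μ ν π) {s : ℝ≥0}
    (hcost : cost h π < (minBall μ s * h s : ℝ≥0)) {z : X} (hz : z ∈ μ.support) :
    0 < π (Metric.ball z s ×ˢ Metric.ball z (2 * s)) := by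
  have hmeas := aemeasurable_cost h_cont hS.isSeparable
    (hπ.ae_fst (p := fun x => x ∈ μ.support) hμ)
  -- By Markov the mass with cost at least `h s` is less than `m(s)`, too little to exhaust the mass
  -- that starts in `B(z,s)`.
  have hmarkov : (h s : ℝ≥0∞) * π {p | (h s : ℝ≥0∞) ≤ h (nndist p.1 p.2)} ≤ cost h π :=
    mul_meas_ge_le_lintegral₀ hmeas _
  have hlt : π {p | (h s : ℝ≥0∞) ≤ h (nndist p.1 p.2)} < μ (Metric.ball z s) := by
    refine lt_of_lt_of_le ?_ (minBall_le hμ hz s)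
    have := hmarkov.trans_lt hcost
    rw [ENNReal.coe_mul, mul_comm (minBall μ s : ℝ≥0∞)] at this
    exact lt_of_mul_lt_mul_left' this
  by_contra h0
  have h0 : π (Metric.ball z s ×ˢ Metric.ball z (2 * s)) = 0 := by simpa using h0
  refine hlt.not_ge ?_
  rw [← hπ.1, Measure.map_apply measurable_fst Metric.isOpen_ball.measurableSet]
  calc π (Prod.fst ⁻¹' Metric.ball z s)
      ≤ π (Metric.ball z s ×ˢ Metric.ball z (2 * s)
          ∪ {p | (h s : ℝ≥0∞) ≤ h (nndist p.1 p.2)}) := by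
        refine measure_mono fun p hp => ?_
        rcases le_or_gt s (nndist p.1 p.2) with hs | hs
        · right
          exact ENNReal.coe_le_coe.2 (h_mono hs)
        · left
          have hp' : dist p.1 z < s := hp
          have hs' : dist p.1 p.2 < s := by exact_mod_cast hs
          refine ⟨hp, ?_⟩
          rw [Metric.mem_ball]
          have := dist_triangle_left p.2 z p.1
          linarith
    _ ≤ _ := (measure_union_le _ _).trans (by rw [h0, zero_add])

/-- If the cost were too small, one could relay mass along a shortcut from `x` to `y`, where `(x,y)`
realizes the essential supremum, and violate cyclical monotonicity. -/
theorem estimateHolds_explicitModulus {h : ℝ≥0 → ℝ≥0} (h_mono : Monotone h)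
    (h_cont : Continuous h) {μ : Measure X} [IsProbabilityMeasure μ] (hμ : μ μ.supportᶜ = 0)
    (hS : IsCompact μ.support) {ρ : ℝ≥0 → ℝ≥0} (hρ0 : ρ 0 = 0) (hρ : ∀ t, 0 < t → 0 < ρ t)
    (hc : UniformlyCyclicallyConvex h ρ μ.support) :
    EstimateHolds h μ (explicitModulus h μ ρ) := by
  intro ν _ hνS π hπ
  have := hπ.1.isProbabilityMeasure
  have hmem : ∀ᵐ q ∂π, q.1 ∈ μ.support ∧ q.2 ∈ μ.support :=
    (hπ.1.ae_fst (p := fun x => x ∈ μ.support) hμ).and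
      (hπ.1.ae_snd (p := fun x => x ∈ μ.support) hνS)
  rcases eq_zero_or_pos (essDist π) with h0 | hpos
  · simp [h0, extend, explicitModulus, hρ0, minBall_zero hμ]
  obtain ⟨x, hx, y, hy, hxy, hU⟩ := exists_nndist_eq_essDist hS hmem hpos
  rw [← hxy, edist_nndist] at hpos ⊢
  have ht : 0 < nndist x y := by exact_mod_cast hpos
  have hext : extend (explicitModulus h μ ρ) (nndist x y) = explicitModulus h μ ρ (nndist x y) := by
    rw [extend, if_neg ENNReal.coe_ne_top, ENNReal.toNNReal_coe]
  rw [hext]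
  by_contra! hcost
  set r := ρ (nndist x y) with hr
  have hr0 : 0 < r := hρ _ ht
  have hr0' : (0 : ℝ) < r := hr0
  have hfin : cost h π ≠ ∞ := (hcost.trans_le le_top).ne
  obtain ⟨N, z, hzS, hz0, hzN, hsum⟩ := hc x hx y hy (by simpa using ht.ne')
  obtain ⟨c, hc1, hc2⟩ := exists_between hsum
  have hnear : {q : X × X | c < h (nndist q.1 q.2)} ∈ 𝓝 (x, y) :=
    (isOpen_lt continuous_const (h_cont.comp continuous_nndist)).mem_nhds hc2
  obtain ⟨δ, hδ, hball⟩ := Metric.mem_nhds_iff.1 hnear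
  rw [← ball_prod_same] at hball
  -- The bound `δ` keeps the cost near `(x,y)` above `c`; the bound `r/4` lets `x` and `y` be
  -- treated like the other chain points.
  set d := min δ (r / 4) with hd
  have hd0 : 0 < d := lt_min hδ (by positivity)
  have hsm : ∀ i ≤ N + 1, 0 < π (Metric.ball (z i) (r / 4) ×ˢ Metric.ball (z i) (r / 2)) := by
    intro i hi
    have := measure_ball_prod_pos h_mono h_cont hμ hS hπ.1 (s := r / 4) hcost (hzS i hi)
    have e1 : ((r / 4 : ℝ≥0) : ℝ) = r / 4 := by push_cast; ring
    have e2 : 2 * ((r / 4 : ℝ≥0) : ℝ) = r / 2 := by push_cast; ring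
    rwa [e2, e1] at this
  -- Index `0` carries the long transport from `x` to `y`, the others the short ones at `z i`. After
  -- rotation the source at `z i` meets the target at `z (i + 1)`, where the ball at `y` serves as
  -- the one at `z (N + 1)`. The errors `r/4` and `r/2` add up to less than `r`.
  have key := hπ.sum_le_sum hfin (finRotate (N + 1))
    (U := fun i => if i = 0 then Metric.ball x d else Metric.ball (z i) (r / 4))
    (V := fun i => if i = 0 then Metric.ball y d else Metric.ball (z i) (r / 2))
    (a := fun i => if i = 0 then c else 0)
    (b := fun i => h (nndist (z i) (z (i + 1)) + r)) ?_ ?_ ?_ ?_ ?_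
  · rw [Finset.sum_ite_eq' Finset.univ (0 : Fin (N + 1)) fun _ => c, if_pos (Finset.mem_univ _),
      Fin.sum_univ_eq_sum_range fun i => h (nndist (z i) (z (i + 1)) + r)] at key
    exact absurd hc1 (not_lt.2 key)
  · intro i; split_ifs <;> exact Metric.isOpen_ball.measurableSet
  · intro i; split_ifs <;> exact Metric.isOpen_ball.measurableSet
  · intro i
    by_cases hi : i = 0
    · simp only [hi, if_true]
      exact hU _ (prod_mem_nhds (Metric.ball_mem_nhds _ hd0) (Metric.ball_mem_nhds _ hd0))
    · simp only [hi, if_false]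
      exact hsm i (by omega)
  · intro i u hu v hv
    by_cases hi : i = 0
    · simp only [hi, if_true] at hu hv ⊢
      exact le_of_lt (hball (mk_mem_prod (Metric.ball_subset_ball (min_le_left _ _) hu)
        (Metric.ball_subset_ball (min_le_left _ _) hv)))
    · simp [hi]
  · intro i u hu v hv
    have hu' : dist u (z i) < r / 4 := by
      by_cases hi : i = 0
      · simp only [hi, if_true] at hu
        simpa [hi, hz0] using lt_of_lt_of_le (Metric.mem_ball.1 hu) (min_le_right _ _)
      · simp only [hi, if_false] at hu
        exact hu
    have hv' : dist v (z (i + 1)) < r / 2 := by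
      by_cases hi : i = Fin.last N
      · subst hi
        simp only [finRotate_last, if_true] at hv
        have := lt_of_lt_of_le (Metric.mem_ball.1 hv) (min_le_right _ _)
        simp only [Fin.val_last, hzN]
        linarith
      · have hlt : (i : ℕ) < N := by
          have := Fin.val_lt_last hi; simpa using this
        have hval : ((finRotate (N + 1) i : Fin (N + 1)) : ℕ) = i + 1 :=
          coe_finRotate_of_ne_last hi
        have hne : finRotate (N + 1) i ≠ 0 := by
          intro h0
          rw [h0] at hval
          simp at hval
        simp only [hne, if_false, hval] at hv
        exact hv
    refine h_mono ?_
    rw [← NNReal.coe_le_coe]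
    push_cast
    have := dist_triangle4 u (z i) (z (i + 1)) v
    rw [dist_comm (z (i + 1)) v] at this
    linarith

end Estimate

/-! ### Plans moving mass to a single point -/

section StarPlan

variable {X : Type*} [MeasurableSpace X]

/-- The plan that leaves `μ₁` in place and moves `μ₂` to the point `y`. -/
def starPlan (μ₁ μ₂ : Measure X) (y : X) : Measure (X × X) :=
  μ₁.map (fun u => (u, u)) + μ₂.map (fun u => (u, y))

theorem measurable_diag : Measurable fun u : X => (u, u) := measurable_id.prodMk measurable_id

theorem starPlan_map_fst (μ₁ μ₂ : Measure X) (y : X) :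
    (starPlan μ₁ μ₂ y).map Prod.fst = μ₁ + μ₂ := by
  rw [starPlan, Measure.map_add _ _ measurable_fst, Measure.map_map measurable_fst measurable_diag,
    Measure.map_map measurable_fst measurable_prodMk_right]
  simp [Function.comp_def]

theorem lintegral_starPlan_map_snd (μ₁ μ₂ : Measure X) (y : X) {ψ : X → ℝ≥0∞} (hψ : Measurable ψ) :
    ∫⁻ x, ψ x ∂((starPlan μ₁ μ₂ y).map Prod.snd) = ∫⁻ x, ψ x ∂μ₁ + ∫⁻ _, ψ y ∂μ₂ := by
  rw [lintegral_map hψ measurable_snd, starPlan, lintegral_add_measure,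
    lintegral_map (f := fun q : X × X => ψ q.2) (hψ.comp measurable_snd) measurable_diag,
    lintegral_map (f := fun q : X × X => ψ q.2) (hψ.comp measurable_snd) measurable_prodMk_right]

end StarPlan

/-! ### Optimality by weak duality -/

section Potentials

variable {X : Type*} [MetricSpace X] [MeasurableSpace X]

/-- A plan whose cost matches the dual value of a pair of potentials is optimal. -/
theorem isOptimalPlan_of_potentials {h : ℝ≥0 → ℝ≥0} {S : Set X} {μ ν : Measure X}
    (hμ : ∀ᵐ x ∂μ, x ∈ S) (hν : ∀ᵐ x ∂ν, x ∈ S) {π : Measure (X × X)} (hπ : IsPlan μ ν π)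
    {φ ψ : X → ℝ≥0∞} (hφ : Measurable φ) (hψ : Measurable ψ)
    (hle : ∀ u ∈ S, ∀ v ∈ S, φ u ≤ h (nndist u v) + ψ v) (hfin : ∫⁻ x, ψ x ∂ν ≠ ∞)
    (hdual : cost h π + ∫⁻ x, ψ x ∂ν ≤ ∫⁻ x, φ x ∂μ) : IsOptimalPlan h μ ν π := by
  refine ⟨hπ, fun π' hπ' => ?_⟩
  -- The potential `ψ` stays on the side of the cost, since values in `[0,∞]` cannot be subtracted
  -- freely; its finite integral cancels.
  refine (ENNReal.add_le_add_iff_right hfin).1 (hdual.trans ?_)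
  calc ∫⁻ x, φ x ∂μ = ∫⁻ q, φ q.1 ∂π' := by rw [← hπ'.1, lintegral_map hφ measurable_fst]
    _ ≤ ∫⁻ q, (h (nndist q.1 q.2) + ψ q.2) ∂π' := by
      refine lintegral_mono_ae ?_
      filter_upwards [hπ'.ae_fst hμ, hπ'.ae_snd hν] with q h1 h2 using hle _ h1 _ h2
    _ = cost h π' + ∫⁻ q, ψ q.2 ∂π' := lintegral_add_right _ (hψ.comp measurable_snd)
    _ = cost h π' + ∫⁻ x, ψ x ∂ν := by rw [← hπ'.2, lintegral_map hψ measurable_snd]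

theorem le_extend {ω : ℝ≥0 → ℝ≥0} (hω : Monotone ω) {t : ℝ≥0} {τ : ℝ≥0∞} (ht : t ≤ τ) :
    (ω t : ℝ≥0∞) ≤ extend ω τ := by
  unfold extend
  split_ifs with hτ
  · exact le_iSup (fun s : ℝ≥0 => (ω s : ℝ≥0∞)) t
  · refine ENNReal.coe_le_coe.2 (hω ?_)
    rwa [← ENNReal.coe_le_coe, ENNReal.coe_toNNReal hτ]

/-- The integrand need not be measurable for the product σ-algebra, so the change of variables is
used only as an inequality, in the direction that holds for all functions. -/
theorem cost_starPlan_le {h : ℝ≥0 → ℝ≥0} (h0 : h 0 = 0) (μ₁ μ₂ : Measure X) (y : X) :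
    cost h (starPlan μ₁ μ₂ y) ≤ ∫⁻ u, h (nndist u y) ∂μ₂ := by
  rw [starPlan, cost_add]
  have h1 : cost h (μ₁.map fun u => (u, u)) ≤ 0 := by
    refine (lintegral_map_le _ _).trans ?_
    simp [h0]
  have h2 : cost h (μ₂.map fun u => (u, y)) ≤ ∫⁻ u, h (nndist u y) ∂μ₂ :=
    lintegral_map_le (fun p : X × X => (h (nndist p.1 p.2) : ℝ≥0∞)) _
  calc _ ≤ 0 + ∫⁻ u, (h (nndist u y) : ℝ≥0∞) ∂μ₂ := add_le_add h1 h2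
    _ = _ := zero_add _

theorem le_essDist_starPlan {μ₁ μ₂ : Measure X} {y : X} {t : ℝ≥0}
    (ht : μ₂ {u | t ≤ nndist u y} ≠ 0) : (t : ℝ≥0∞) ≤ essDist (starPlan μ₁ μ₂ y) := by
  by_contra! hlt
  have hae : ∀ᵐ q ∂(starPlan μ₁ μ₂ y), edist q.1 q.2 ≤ essDist (starPlan μ₁ μ₂ y) :=
    ENNReal.ae_le_essSup _
  have h0 : (starPlan μ₁ μ₂ y) {q | (t : ℝ≥0∞) ≤ edist q.1 q.2} = 0 := by
    rw [measure_eq_zero_iff_ae_notMem]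
    filter_upwards [hae] with q hq
    exact not_le.2 (hq.trans_lt hlt)
  refine ht (le_antisymm ?_ zero_le)
  rw [← h0]
  calc μ₂ {u | t ≤ nndist u y}
      = μ₂ ((fun u => (u, y)) ⁻¹' {q : X × X | (t : ℝ≥0∞) ≤ edist q.1 q.2}) := by
        simp only [edist_nndist, ENNReal.coe_le_coe, preimage_ofPred_eq]
    _ ≤ μ₂.map (fun u => (u, y)) {q | (t : ℝ≥0∞) ≤ edist q.1 q.2} :=
        Measure.le_map_apply measurable_prodMk_right.aemeasurable _
    _ ≤ _ := by
        rw [starPlan, Measure.add_apply]; exact le_add_self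

end Potentials

/-! ### Optimal star plans from gauges -/

section Star

variable {X : Type*} [MetricSpace X] [MeasurableSpace X]

/-- `F` is a bounded measurable function vanishing at `y` and satisfying
`F u ≤ F v + h (d(u,v))` on `S`. -/
structure IsGauge (h : ℝ≥0 → ℝ≥0) (S : Set X) (y : X) (F : X → ℝ≥0) (M : ℝ≥0) : Prop where
  measurable : Measurable F
  le_bound : ∀ u, F u ≤ M
  apply_center : F y = 0
  le_add : ∀ u ∈ S, ∀ v ∈ S, F u ≤ F v + h (nndist u v)

variable [BorelSpace X]

theorem measurable_cost_to {h : ℝ≥0 → ℝ≥0} (h_cont : Continuous h) (y : X) :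
    Measurable fun u : X => h (nndist u y) :=
  (h_cont.comp (continuous_id.nndist continuous_const)).measurable

/-- Given a gauge `F` and a level `s`, moving to `y` mass at points with `h (d(u,y)) ≤ F u + s` and
leaving in place mass at points with `h (d(u,y)) ≥ F u + s` is optimal. -/
theorem EstimateHolds.le_lintegral_star {h ω : ℝ≥0 → ℝ≥0} (h_cont : Continuous h) (h0 : h 0 = 0)
    {μ : Measure X} [IsProbabilityMeasure μ] (hμ : μ μ.supportᶜ = 0) (hω : Monotone ω)
    (hest : EstimateHolds h μ ω) {y : X} (hy : y ∈ μ.support) {F : X → ℝ≥0} {M : ℝ≥0}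
    (hF : IsGauge h μ.support y F M) (s : ℝ≥0) {μ₁ μ₂ : Measure X} (hsum : μ₁ + μ₂ = μ)
    (h1 : ∀ᵐ u ∂μ₁, F u + s ≤ h (nndist u y)) (h2 : ∀ᵐ u ∂μ₂, h (nndist u y) ≤ F u + s)
    {t : ℝ≥0} (ht : μ₂ {u | t ≤ nndist u y} ≠ 0) :
    (ω t : ℝ≥0∞) ≤ ∫⁻ u, h (nndist u y) ∂μ₂ := by
  classical
  set π := starPlan μ₁ μ₂ y with hπdef
  have hplan : IsPlan μ (π.map Prod.snd) π := ⟨by rw [hπdef, starPlan_map_fst, hsum], rfl⟩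
  have : IsProbabilityMeasure π := hplan.isProbabilityMeasure
  have hν : IsProbabilityMeasure (π.map Prod.snd) :=
    Measure.isProbabilityMeasure_map measurable_snd.aemeasurable
  have hSm : MeasurableSet μ.supportᶜ := Measure.isOpen_compl_support.measurableSet
  have hle1 : μ₁ ≤ μ := by rw [← hsum]; exact Measure.le_add_right le_rfl
  have hνS : (π.map Prod.snd) μ.supportᶜ = 0 := by
    rw [← lintegral_indicator_one hSm, hπdef,
      lintegral_starPlan_map_snd _ _ _ (measurable_one.indicator hSm)]
    simp only [lintegral_indicator_one hSm, mem_compl_iff, hy, not_true_eq_false,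
      not_false_eq_true, indicator_of_notMem, lintegral_zero, add_zero]
    exact le_antisymm ((hle1 _).trans hμ.le) zero_le
  -- The constraint on `φ, ψ` is the first entry of the minimum when `v = y` and the gauge
  -- inequality otherwise. The dual value is reached because `φ u = F u + s` for mass that stays and
  -- `φ u = h (d(u,y))` for mass that moves, with `ψ y = 0`.
  let φ : X → ℝ≥0∞ := fun u => min (h (nndist u y)) (F u + s)
  let ψ : X → ℝ≥0∞ := fun v => if v = y then 0 else F v + s
  have hFm : Measurable fun u => (F u : ℝ≥0∞) + s :=
    hF.measurable.coe_nnreal_ennreal.add measurable_const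
  have hφ : Measurable φ := (measurable_cost_to h_cont y).coe_nnreal_ennreal.min hFm
  have hψ : Measurable ψ := Measurable.ite (measurableSet_singleton y) measurable_const hFm
  have hψle : ∀ v, ψ v ≤ F v + s := by
    intro v
    simp only [ψ]
    split_ifs
    · exact zero_le
    · exact le_rfl
  have hopt : IsOptimalPlan h μ (π.map Prod.snd) π := by
    refine isOptimalPlan_of_potentials (S := μ.support) hμ hνS hplan hφ hψ ?_ ?_ ?_
    · intro u hu v hv
      by_cases hvy : v = y
      · simp [φ, ψ, hvy]
      · simp only [ψ, if_neg hvy]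
        refine (min_le_right _ _).trans ?_
        have := hF.le_add u hu v hv
        calc (F u : ℝ≥0∞) + s ≤ (F v + h (nndist u v) : ℝ≥0) + s := by gcongr
          _ = _ := by push_cast; ring
    · refine ne_of_lt (lt_of_le_of_lt (lintegral_mono (g := fun _ => (M : ℝ≥0∞) + s)
        fun v => (hψle v).trans ?_) ?_)
      · exact add_le_add_left (ENNReal.coe_le_coe.2 (hF.le_bound v)) _
      · simp only [lintegral_const, measure_univ, mul_one]
        exact ENNReal.add_lt_top.2 ⟨ENNReal.coe_lt_top, ENNReal.coe_lt_top⟩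
    · rw [hπdef, lintegral_starPlan_map_snd _ _ _ hψ, ← hsum, lintegral_add_measure, add_comm]
      have e1 : ∫⁻ x, ψ x ∂μ₁ ≤ ∫⁻ x, φ x ∂μ₁ := by
        refine lintegral_mono_ae ?_
        filter_upwards [h1] with u hu
        exact (hψle u).trans (le_min (by exact_mod_cast hu) le_rfl)
      have e2 : ∫⁻ u, h (nndist u y) ∂μ₂ ≤ ∫⁻ x, φ x ∂μ₂ := by
        refine lintegral_mono_ae ?_
        filter_upwards [h2] with u hu
        exact le_min le_rfl (by exact_mod_cast hu)
      have e3 : ∫⁻ _, ψ y ∂μ₂ = 0 := by simp [ψ]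
      rw [e3, add_zero]
      exact add_le_add e1 ((cost_starPlan_le h0 _ _ _).trans e2)
  exact (le_extend hω (le_essDist_starPlan ht)).trans
    ((hest _ hν hνS π hopt).trans (cost_starPlan_le h0 _ _ _))

/-- If points at distance at least `t` may stay or move to `y`, then the mass that has to move
costs at least `ω t`. -/
theorem EstimateHolds.le_setLIntegral_lt {h ω : ℝ≥0 → ℝ≥0} (h_cont : Continuous h) (h0 : h 0 = 0)
    {μ : Measure X} [IsProbabilityMeasure μ] (hμ : μ μ.supportᶜ = 0) (hω : Monotone ω)
    (hest : EstimateHolds h μ ω) {y : X} (hy : y ∈ μ.support) {F : X → ℝ≥0} {M : ℝ≥0}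
    (hF : IsGauge h μ.support y F M) {s t : ℝ≥0} {A : Set X} (hAm : MeasurableSet A)
    (hA : ∀ u ∈ A, h (nndist u y) = F u + s) (hAt : ∀ u ∈ A, t ≤ nndist u y) (hA0 : μ A ≠ 0) :
    (ω t : ℝ≥0∞) ≤ ∫⁻ u in {u | h (nndist u y) < F u + s}, h (nndist u y) ∂μ := by
  set B := {u | h (nndist u y) < F u + s} with hB
  have hBm : MeasurableSet B :=
    measurableSet_lt (measurable_cost_to h_cont y) (hF.measurable.add measurable_const)
  have hdisj : Disjoint B A := Set.disjoint_left.2 fun u hu hu' => (hA u hu').not_lt hu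
  refine ENNReal.le_of_forall_pos_le_add fun ε hε _ => ?_
  -- Only the fraction `a` of the ties `A` is moved. This already makes the essential supremum at
  -- least `t`, at an extra cost of at most `a * (M + s) ≤ ε`.
  set a : ℝ≥0 := min 1 (ε / (M + s + 1)) with ha
  have ha0 : 0 < a := lt_min one_pos (div_pos hε (by positivity))
  have haε : a * (M + s) ≤ ε := by
    calc a * (M + s) ≤ ε / (M + s + 1) * (M + s + 1) := by
          exact mul_le_mul' (min_le_right _ _) le_self_add
      _ = ε := div_mul_cancel₀ _ (by positivity)
  have key := hest.le_lintegral_star h_cont h0 hμ hω hy hF s (t := t)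
    (μ₁ := μ.restrict (B ∪ A)ᶜ + (1 - a) • μ.restrict A) (μ₂ := μ.restrict B + a • μ.restrict A)
    ?_ ?_ ?_ ?_
  · refine key.trans ?_
    rw [lintegral_add_measure]
    gcongr
    rw [ENNReal.smul_def, lintegral_smul_measure]
    calc (a : ℝ≥0∞) • ∫⁻ u in A, h (nndist u y) ∂μ ≤ a * ∫⁻ _, (M + s : ℝ≥0) ∂μ := by
          rw [smul_eq_mul]
          refine mul_le_mul_right ?_ _
          refine (setLIntegral_mono' hAm (g := fun _ => ((M + s : ℝ≥0) : ℝ≥0∞))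
            fun u hu => ?_).trans (setLIntegral_le_lintegral _ _)
          rw [hA u hu]
          exact_mod_cast add_le_add_left (hF.le_bound u) s
      _ ≤ ε := by
          simp only [lintegral_const, measure_univ, mul_one]
          exact_mod_cast haε
  · have e1 : μ.restrict B + μ.restrict A = μ.restrict (B ∪ A) :=
      (Measure.restrict_union hdisj hAm).symm
    have e2 : (1 - a) • μ.restrict A + a • μ.restrict A = μ.restrict A := by
      rw [← add_smul, tsub_add_cancel_of_le (min_le_left _ _), one_smul]
    calc _ = μ.restrict (B ∪ A)ᶜ + (μ.restrict B + ((1 - a) • μ.restrict A + a • μ.restrict A)) := by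
          abel
      _ = μ := by rw [e2, e1, add_comm, Measure.restrict_add_restrict_compl (hBm.union hAm)]
  · rw [ae_add_measure_iff]
    constructor
    · filter_upwards [ae_restrict_mem (hBm.union hAm).compl] with u hu
      exact not_lt.1 fun hlt => hu (Or.inl hlt)
    · refine Measure.ae_smul_measure ?_ _
      filter_upwards [ae_restrict_mem hAm] with u hu using (hA u hu).ge
  · rw [ae_add_measure_iff]
    constructor
    · filter_upwards [ae_restrict_mem hBm] with u hu using le_of_lt hu
    · refine Measure.ae_smul_measure ?_ _
      filter_upwards [ae_restrict_mem hAm] with u hu using (hA u hu).le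
  · have hpos : 0 < (a • μ.restrict A) {u | t ≤ nndist u y} := by
      rw [Measure.smul_apply, ENNReal.smul_def, smul_eq_mul,
        Measure.restrict_apply_superset (t := {u | t ≤ nndist u y}) fun u hu => hAt u hu]
      exact ENNReal.mul_pos (by exact_mod_cast ha0.ne') hA0
    rw [Measure.add_apply]
    exact (hpos.trans_le le_add_self).ne'

/-- If mass at distance at least `t` is moved to `y` at every level above `s`, then the mass moved
at level `s` costs at least `ω t`. -/
theorem EstimateHolds.le_setLIntegral_le {h ω : ℝ≥0 → ℝ≥0} (h_cont : Continuous h) (h0 : h 0 = 0)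
    {μ : Measure X} [IsProbabilityMeasure μ] (hμ : μ μ.supportᶜ = 0) (hω : Monotone ω)
    (hest : EstimateHolds h μ ω) {y : X} (hy : y ∈ μ.support) {F : X → ℝ≥0} {M : ℝ≥0}
    (hF : IsGauge h μ.support y F M) {s t : ℝ≥0}
    (hpos : ∀ s', s < s' → μ {u | h (nndist u y) ≤ F u + s' ∧ t ≤ nndist u y} ≠ 0) :
    (ω t : ℝ≥0∞) ≤ ∫⁻ u in {u | h (nndist u y) ≤ F u + s}, h (nndist u y) ∂μ := by
  have hkm := measurable_cost_to h_cont y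
  let L : ℝ≥0 → Set X := fun s => {u | h (nndist u y) ≤ F u + s}
  have hLm : ∀ s, MeasurableSet (L s) := fun s =>
    measurableSet_le hkm (hF.measurable.add measurable_const)
  obtain ⟨σ, hσanti, hσlt, hσlim⟩ := exists_seq_strictAnti_tendsto s
  -- Viewing the cost as a measure lets the bounds at levels `σ n ↓ s` pass to `s` by continuity
  -- from above.
  let κ := μ.withDensity fun u => (h (nndist u y) : ℝ≥0∞)
  have hκ : ∀ s, κ (L s) = ∫⁻ u in L s, h (nndist u y) ∂μ := fun s => withDensity_apply _ (hLm s)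
  have hstep : ∀ n, (ω t : ℝ≥0∞) ≤ κ (L (σ n)) := by
    intro n
    rw [hκ]
    refine hest.le_lintegral_star h_cont h0 hμ hω hy hF (σ n) (μ₁ := μ.restrict (L (σ n))ᶜ)
      (by rw [add_comm, Measure.restrict_add_restrict_compl (hLm _)]) ?_ ?_ ?_
    · filter_upwards [ae_restrict_mem (hLm (σ n)).compl] with u hu
      exact le_of_lt (not_le.1 hu)
    · filter_upwards [ae_restrict_mem (hLm (σ n))] with u hu using hu
    · rw [Measure.restrict_apply' (hLm _)]
      intro hz
      refine hpos _ (hσlt n) (measure_mono_null (fun u hu => ?_) hz)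
      exact ⟨hu.2, hu.1⟩
  have hinter : ⋂ n, L (σ n) = L s := by
    ext u
    simp only [L, mem_iInter, mem_ofPred_eq]
    refine ⟨fun H => ?_, fun H n => H.trans (by gcongr; exact (hσlt n).le)⟩
    exact ge_of_tendsto' (tendsto_const_nhds.add hσlim) H
  have hlim : Tendsto (fun n => κ (L (σ n))) atTop (𝓝 (κ (L s))) := by
    rw [← hinter]
    refine tendsto_measure_iInter_atTop (fun n => (hLm _).nullMeasurableSet) ?_ ⟨0, ?_⟩
    · intro m n hmn u hu
      exact (mem_ofPred.1 hu).trans (add_le_add_right (hσanti.antitone hmn) _)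
    · rw [hκ]
      refine ne_of_lt (lt_of_le_of_lt ((setLIntegral_mono' (hLm _)
        (g := fun _ => ((M + σ 0 : ℝ≥0) : ℝ≥0∞)) fun u hu => ?_).trans
        (setLIntegral_le_lintegral _ _)) ?_)
      · exact ENNReal.coe_le_coe.2
          (le_trans (mem_ofPred.1 hu) (add_le_add_left (hF.le_bound u) _))
      · simp only [lintegral_const, measure_univ, mul_one]
        exact ENNReal.coe_lt_top
  rw [← hκ]
  exact ge_of_tendsto' hlim hstep

end Star

/-! ### The estimate forces compact support -/

section Compactness

theorem isGauge_zero {X : Type*} [MetricSpace X] [MeasurableSpace X] (h : ℝ≥0 → ℝ≥0) (S : Set X) (y : X) :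
    IsGauge h S y (fun _ => 0) 0 := ⟨measurable_const, by simp, rfl, by simp⟩

variable {X : Type*} [MetricSpace X] [MeasurableSpace X] [BorelSpace X]

/-- Otherwise an infinite `ε`-separated sequence would give infinitely many disjoint balls of radius
`ε/2`, each of mass at least `η`, in a finite measure. -/
theorem totallyBounded_of_measure_ball_ge {μ : Measure X} [IsFiniteMeasure μ] {S : Set X}
    (H : ∀ t : ℝ, 0 < t → ∃ η : ℝ≥0∞, 0 < η ∧ ∀ y ∈ S, η ≤ μ (Metric.ball y t)) :
    TotallyBounded S := by
  rw [Metric.totallyBounded_iff]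
  intro ε hε
  by_contra! hcon
  have : Std.Symm fun x y : X => ε ≤ dist x y := ⟨fun x y hxy => by rwa [dist_comm]⟩
  obtain ⟨f, hfS, hf⟩ := exists_seq_of_forall_finset_exists' (fun x => x ∈ S)
    (fun x y : X => ε ≤ dist x y) fun s _ => by
      obtain ⟨y, hyS, hy⟩ := not_subset.1 (hcon s s.finite_toSet)
      refine ⟨y, hyS, fun x hx => ?_⟩
      by_contra! hlt
      exact hy (mem_iUnion₂.2 ⟨x, hx, by rwa [Metric.mem_ball, dist_comm]⟩)
  obtain ⟨η, hη, hball⟩ := H (ε / 2) (half_pos hε)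
  have hdisj : Pairwise fun m n =>
      Disjoint (Metric.ball (f m) (ε / 2)) (Metric.ball (f n) (ε / 2)) := by
    intro m n hmn
    refine Metric.ball_disjoint_ball ?_
    rw [add_halves]
    exact hf hmn
  have hfin := Measure.finite_const_le_meas_of_disjoint_iUnion μ hη
    (fun n => Metric.isOpen_ball.measurableSet) hdisj (measure_ne_top _ _)
  refine Set.infinite_univ (α := ℕ) (hfin.subset fun n _ => hball _ (hfS n))

theorem setLIntegral_le_mul_measure_ball {h : ℝ≥0 → ℝ≥0} (h_mono : Monotone h) {μ : Measure X}
    {y : X} {t : ℝ≥0} {D : Set X} (hD : MeasurableSet D) (h0 : μ (D ∩ {u | t ≤ nndist u y}) = 0) :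
    ∫⁻ u in D, h (nndist u y) ∂μ ≤ h t * μ (Metric.ball y t) := by
  have hb : MeasurableSet (Metric.ball y (t : ℝ)) := Metric.isOpen_ball.measurableSet
  calc ∫⁻ u in D, h (nndist u y) ∂μ
      ≤ ∫⁻ u in D, (Metric.ball y (t : ℝ)).indicator (fun _ => (h t : ℝ≥0∞)) u ∂μ := by
        refine lintegral_mono_ae ((ae_restrict_iff' hD).2 ?_)
        filter_upwards [measure_eq_zero_iff_ae_notMem.1 h0] with u hu huD
        have hlt : nndist u y < t := by
          by_contra! hle
          exact hu ⟨huD, hle⟩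
        rw [indicator_of_mem (show u ∈ Metric.ball y (t : ℝ) by
          rw [Metric.mem_ball]; exact_mod_cast hlt)]
        exact_mod_cast h_mono hlt.le
    _ ≤ ∫⁻ u, (Metric.ball y (t : ℝ)).indicator (fun _ => (h t : ℝ≥0∞)) u ∂μ :=
        setLIntegral_le_lintegral _ _
    _ = h t * μ (Metric.ball y t) := lintegral_indicator_const hb _

/-- With the gauge `0` the points cheapest to move to `y` go first. At the level where far mass is
about to move, almost all the mass that has to move lies in `B(y,t)`, so it costs at most `h t * μ
(B(y,t))`. -/
theorem EstimateHolds.le_mul_measure_ball {h ω : ℝ≥0 → ℝ≥0} (h_mono : Monotone h)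
    (h_cont : Continuous h) (h0 : h 0 = 0)
    {μ : Measure X} [IsProbabilityMeasure μ] (hμ : μ μ.supportᶜ = 0) (hω : Monotone ω)
    (hest : EstimateHolds h μ ω) {y : X} (hy : y ∈ μ.support) {t : ℝ≥0}
    (hfar : μ {u | t ≤ nndist u y} ≠ 0) : (ω t : ℝ≥0∞) ≤ h t * μ (Metric.ball y t) := by
  have hkm := measurable_cost_to h_cont y
  have hdm : MeasurableSet {u | t ≤ nndist u y} :=
    measurableSet_le measurable_const (continuous_id.nndist continuous_const).measurable
  have hF := isGauge_zero h μ.support y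
  let E : Set ℝ≥0 := {s | μ {u | h (nndist u y) ≤ s ∧ t ≤ nndist u y} ≠ 0}
  have hE : E.Nonempty := by
    by_contra hne
    refine hfar (measure_mono_null (t := ⋃ n : ℕ, {u | h (nndist u y) ≤ n ∧ t ≤ nndist u y})
      (fun u hu => ?_) (measure_iUnion_null fun n => ?_))
    · obtain ⟨n, hn⟩ := exists_nat_ge (h (nndist u y))
      exact mem_iUnion.2 ⟨n, hn, hu⟩
    · by_contra hn
      exact hne ⟨n, hn⟩
  -- The critical level. If no far mass moves at `s`, it does at every level above, and one passes
  -- to the limit. Otherwise the far mass sits on the tie `h (d(u,y)) = s`.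
  set s := sInf E with hs
  have hbelow : ∀ s' < s, μ {u | h (nndist u y) ≤ s' ∧ t ≤ nndist u y} = 0 := by
    intro s' hs'
    by_contra hn
    exact hs'.not_ge (csInf_le (OrderBot.bddBelow E) hn)
  by_cases hcase : μ {u | h (nndist u y) ≤ s ∧ t ≤ nndist u y} = 0
  · have key := hest.le_setLIntegral_le h_cont h0 hμ hω hy hF (s := s) (t := t) fun s' hs' => by
      obtain ⟨s₁, hs₁, hlt⟩ := exists_lt_of_csInf_lt hE hs'
      refine fun hz => hs₁ (measure_mono_null (fun u hu => ?_) hz)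
      exact ⟨by simpa using hu.1.trans hlt.le, hu.2⟩
    simp only [zero_add] at key
    exact key.trans (setLIntegral_le_mul_measure_ball h_mono
      (measurableSet_le hkm measurable_const) hcase)
  · have hlow : μ ({u | h (nndist u y) < s} ∩ {u | t ≤ nndist u y}) = 0 := by
      rcases eq_zero_or_pos s with hs0 | hs0
      · simp [hs0]
      · obtain ⟨σ, -, hσ, hσlim⟩ := exists_seq_strictMono_tendsto' hs0
        refine measure_mono_null (t := ⋃ n, {u | h (nndist u y) ≤ σ n ∧ t ≤ nndist u y})
          (fun u hu => ?_) (measure_iUnion_null fun n => hbelow _ (hσ n).2)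
        obtain ⟨n, hn⟩ := (hσlim.eventually_const_lt hu.1).exists
        exact mem_iUnion.2 ⟨n, hn.le, hu.2⟩
    have key := hest.le_setLIntegral_lt h_cont h0 hμ hω hy hF (s := s) (t := t)
      (A := {u | h (nndist u y) = s} ∩ {u | t ≤ nndist u y})
      ((measurableSet_eq_fun hkm measurable_const).inter hdm) (fun u hu => by simpa using hu.1)
      (fun u hu => hu.2) fun hz => hcase (measure_mono_null (fun u hu => ?_)
        (measure_union_null hlow hz))
    · simp only [zero_add] at key
      exact key.trans (setLIntegral_le_mul_measure_ball h_mono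
        (measurableSet_lt hkm measurable_const) hlow)
    · rcases hu.1.lt_or_eq with hlt | heq
      · exact Or.inl ⟨hlt, hu.2⟩
      · exact Or.inr ⟨heq, hu.2⟩

theorem EstimateHolds.isCompact_support [CompleteSpace X] {h ω : ℝ≥0 → ℝ≥0} (h_mono : Monotone h)
    (h_cont : Continuous h) (h0 : h 0 = 0) {μ : Measure X} [IsProbabilityMeasure μ]
    (hμ : μ μ.supportᶜ = 0) (hω : IsModulus ω) (hest : EstimateHolds h μ ω) :
    IsCompact μ.support := by
  refine (totallyBounded_of_measure_ball_ge (μ := μ) fun t ht => ?_).isCompact_of_isClosed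
    Measure.isClosed_support
  lift t to ℝ≥0 using ht.le
  have ht : 0 < t := ht
  -- The value `1` covers points `y` whose ball of radius `t` already has full measure.
  refine ⟨min 1 (ω t / h t), lt_min one_pos
    (ENNReal.div_pos (by exact_mod_cast (hω.2 t ht).ne') ENNReal.coe_ne_top), fun y hy => ?_⟩
  by_cases hfar : μ {u | t ≤ nndist u y} = 0
  · refine (min_le_left _ _).trans (ge_of_eq ?_)
    rw [prob_compl_eq_zero_iff Metric.isOpen_ball.measurableSet |>.1]
    refine measure_mono_null (fun u hu => ?_) hfar
    have hu : ¬ dist u y < t := hu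
    exact_mod_cast not_lt.1 hu
  · refine (min_le_right _ _).trans (ENNReal.div_le_of_le_mul' ?_)
    exact hest.le_mul_measure_ball h_mono h_cont h0 hμ hω.1 hy hfar

end Compactness

/-! ### Infimal chain cost -/

section Chains

variable {X : Type*} [MetricSpace X]

/-- Finite sequences in `S` ending at `y`. -/
abbrev ChainTo (S : Set X) (y : X) : Type _ :=
  {p : ℕ × (ℕ → X) // (∀ i ≤ p.1, p.2 i ∈ S) ∧ p.2 p.1 = y}

/-- The cost of first jumping from `u` to the start of the chain `p` and then following it. -/
def chainCost (h : ℝ≥0 → ℝ≥0) {S : Set X} {y : X} (p : ChainTo S y) (u : X) : ℝ≥0 :=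
  h (nndist u (p.1.2 0)) + ∑ i ∈ Finset.range p.1.1, h (nndist (p.1.2 i) (p.1.2 (i + 1)))

/-- The infimal cost of a chain through `S` from `u` to `y`. -/
def chainDist (h : ℝ≥0 → ℝ≥0) (S : Set X) (y u : X) : ℝ≥0 :=
  ⨅ p : ChainTo S y, chainCost h p u

/-- The chain obtained by putting `v` in front of `p`. -/
def ChainTo.cons {S : Set X} {y : X} (p : ChainTo S y) {v : X} (hv : v ∈ S) : ChainTo S y :=
  ⟨(p.1.1 + 1, fun i => Nat.casesOn i v p.1.2), fun i hi => by
    cases i with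
    | zero => exact hv
    | succ i => exact p.2.1 i (by simpa using hi), p.2.2⟩

theorem chainCost_cons (h : ℝ≥0 → ℝ≥0) {S : Set X} {y : X} (p : ChainTo S y) {v : X} (hv : v ∈ S)
    (u : X) : chainCost h (p.cons hv) u = chainCost h p v + h (nndist u v) := by
  simp only [chainCost, ChainTo.cons, Finset.sum_range_succ']
  rw [add_comm (∑ i ∈ Finset.range p.1.1, _), add_comm]
  rfl

theorem chainDist_le (h : ℝ≥0 → ℝ≥0) {S : Set X} {y : X} (p : ChainTo S y) (u : X) :
    chainDist h S y u ≤ chainCost h p u := ciInf_le (OrderBot.bddBelow _) p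

theorem nonempty_chainTo {X : Type*} {S : Set X} {y : X} (hy : y ∈ S) : Nonempty (ChainTo S y) :=
  ⟨⟨(0, fun _ => y), fun _ _ => hy, rfl⟩⟩

theorem chainDist_le_apply (h : ℝ≥0 → ℝ≥0) {S : Set X} {y : X} (hy : y ∈ S) (u : X) :
    chainDist h S y u ≤ h (nndist u y) := by
  simpa [chainCost] using chainDist_le h (⟨(0, fun _ => y), fun _ _ => hy, rfl⟩ : ChainTo S y) u

/-- Any chain from `v` to `y` becomes one that `u` can follow by putting `v` in front. -/
theorem chainDist_le_add (h : ℝ≥0 → ℝ≥0) {S : Set X} {y : X} (hy : y ∈ S) (u : X) {v : X}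
    (hv : v ∈ S) : chainDist h S y u ≤ chainDist h S y v + h (nndist u v) := by
  have := nonempty_chainTo hy
  rw [← tsub_le_iff_right]
  refine le_ciInf fun p => ?_
  rw [tsub_le_iff_right, ← chainCost_cons h p hv]
  exact chainDist_le h _ u

theorem le_chainDist {h : ℝ≥0 → ℝ≥0} {S : Set X} {x y : X} (hx : x ∈ S) (hy : y ∈ S)
    (H : ¬ HasShortcut h S 0 x y) : h (nndist x y) ≤ chainDist h S y x := by
  have := nonempty_chainTo hy
  refine le_ciInf fun p => ?_
  by_contra! hlt
  refine H ⟨p.1.1, (p.cons hx).1.2, (p.cons hx).2.1, rfl, (p.cons hx).2.2, ?_⟩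
  simpa [ChainTo.cons, Finset.sum_range_succ', chainCost, add_comm] using hlt

/-- An infimum of continuous functions is upper semicontinuous, so the uncountable family of chains
does no harm. -/
theorem measurable_chainDist [MeasurableSpace X] [BorelSpace X] {h : ℝ≥0 → ℝ≥0}
    (h_cont : Continuous h) (S : Set X) (y : X) : Measurable (chainDist h S y) := by
  refine UpperSemicontinuous.measurable (upperSemicontinuous_ciInf
    (fun _ => OrderBot.bddBelow _) fun p => Continuous.upperSemicontinuous ?_)
  exact (h_cont.comp (continuous_id.nndist continuous_const)).add continuous_const

end Chains

/-! ### The estimate forces shortcuts -/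

section Convexity

variable {X : Type*} [MetricSpace X] [MeasurableSpace X] [BorelSpace X]

/-- The truncation at `c` supplies the bound and preserves the gauge inequality; with `c = h
(d(x,y))` it loses nothing at a point `x` that has no shortcut to `y`. -/
theorem isGauge_chainDist {h : ℝ≥0 → ℝ≥0} (h_cont : Continuous h) (h0 : h 0 = 0) {S : Set X} {y : X}
    (hy : y ∈ S) (c : ℝ≥0) : IsGauge h S y (fun u => min (chainDist h S y u) c) c where
  measurable := (measurable_chainDist h_cont S y).min measurable_const
  le_bound u := min_le_right _ _
  apply_center := by
    have : chainDist h S y y = 0 :=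
      le_antisymm ((chainDist_le_apply h hy y).trans (by simp [h0])) zero_le
    simp [this]
  le_add u _ v hv := by
    refine le_trans (le_min ?_ ?_) (min_add_add_right _ _ _).le
    · exact (min_le_left _ _).trans (chainDist_le_add h hy u hv)
    · exact (min_le_right _ _).trans le_self_add

/-- Without a shortcut, `F x = h (d(x,y))`, so that mass near `x` moves at every level `s > 0`. In
the limit `s = 0` the moved mass has positive cost, but ties away from `y` are null. -/
theorem EstimateHolds.strictlyCyclicallyConvex {h ω : ℝ≥0 → ℝ≥0}
    (h_cont : Continuous h) (h0 : h 0 = 0) {μ : Measure X} [IsProbabilityMeasure μ] (hμ : μ μ.supportᶜ = 0) (hω : IsModulus ω)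
    (hest : EstimateHolds h μ ω) : StrictlyCyclicallyConvex h μ.support := by
  intro x hx y hy hxy
  by_contra hcon
  have hns : ¬ HasShortcut h μ.support 0 x y := by simpa [HasShortcut] using hcon
  set c := h (nndist x y) with hc
  set F : X → ℝ≥0 := fun u => min (chainDist h μ.support y u) c with hFdef
  have hF : IsGauge h μ.support y F c := isGauge_chainDist h_cont h0 hy c
  have hkm := measurable_cost_to h_cont y
  have hFx : F x = c := min_eq_right (le_chainDist hx hy hns)
  have hFle : ∀ u, F u ≤ h (nndist u y) := fun u =>
    (min_le_left _ _).trans (chainDist_le_apply h hy u)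
  have hnd : Continuous fun u : X => nndist u y := continuous_id.nndist continuous_const
  -- Since `F u ≤ h (d(u,y))`, no mass is forced to move at level `0`. Ties of positive mass at
  -- distance at least `t` would thus give `ω t ≤ 0`.
  have htie : ∀ t, 0 < t → μ {u | h (nndist u y) ≤ F u + 0 ∧ t ≤ nndist u y} = 0 := by
    intro t ht
    by_contra hne
    have key := hest.le_setLIntegral_lt h_cont h0 hμ hω.1 hy hF (s := 0) (t := t)
      ((measurableSet_le hkm (hF.measurable.add measurable_const)).inter
        (measurableSet_le measurable_const hnd.measurable))
      (fun u hu => le_antisymm hu.1 (by simpa using hFle u)) (fun u hu => hu.2) hne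
    have hempty : {u | h (nndist u y) < F u + 0} = ∅ := by
      ext u
      simpa using hFle u
    rw [hempty] at key
    simp only [Measure.restrict_empty, lintegral_zero_measure, nonpos_iff_eq_zero,
      ENNReal.coe_eq_zero] at key
    exact (hω.2 t ht).ne' key
  set t := nndist x y / 2 with ht
  have hd : 0 < nndist x y := pos_iff_ne_zero.2 (by simpa using hxy)
  have ht0 : 0 < t := half_pos hd
  -- Near `x`, `c = F x ≤ F u + h (d(x,u))` and `h (d(u,y))` is close to `c`, so `h (d(u,y)) ≤ F u +
  -- s`. Such neighbourhoods have positive mass because `x` lies in the support, and they stay at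
  -- distance more than `t` from `y`.
  have key := hest.le_setLIntegral_le h_cont h0 hμ hω.1 hy hF (s := 0) (t := t) fun s hs => by
    have c1 : ∀ᶠ u in 𝓝 x, h (nndist u y) < c + s / 2 :=
      (h_cont.comp hnd).continuousAt.eventually_lt continuousAt_const
        (lt_add_of_pos_right _ (half_pos hs))
    have c2 : ∀ᶠ u in 𝓝 x, h (nndist x u) < s / 2 :=
      (h_cont.comp (continuous_const.nndist continuous_id)).continuousAt.eventually_lt
        continuousAt_const (by simpa [h0] using hs)
    have c3 : ∀ᶠ u in 𝓝 x, t < nndist u y :=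
      continuousAt_const.eventually_lt hnd.continuousAt (half_lt_self hd)
    have hpos := (Measure.mem_support_iff_forall x).1 hx _ (c1.and (c2.and c3))
    refine fun hz => hpos.ne' (measure_mono_null (t := μ.supportᶜ ∪ _) (fun u hu => ?_)
      (measure_union_null hμ hz))
    by_cases huS : u ∈ μ.support
    · right
      obtain ⟨hu1, hu2, hu3⟩ := hu
      refine ⟨?_, hu3.le⟩
      have := hF.le_add x hx u huS
      rw [hFx] at this
      calc h (nndist u y) ≤ c + s / 2 := hu1.le
        _ ≤ (F u + h (nndist x u)) + s / 2 := by gcongr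
        _ ≤ (F u + s / 2) + s / 2 := by gcongr
        _ = F u + s := by rw [add_assoc, add_halves]
    · exact Or.inl huS
  have hzero : ∫⁻ u in {u | h (nndist u y) ≤ F u + 0}, h (nndist u y) ∂μ = 0 := by
    have hLm : MeasurableSet {u | h (nndist u y) ≤ F u + 0} :=
      measurableSet_le hkm (hF.measurable.add measurable_const)
    rw [setLIntegral_eq_zero_iff hLm hkm.coe_nnreal_ennreal]
    obtain ⟨σ, -, hσ, hσlim⟩ := exists_seq_strictAnti_tendsto (0 : ℝ≥0)
    filter_upwards [ae_all_iff.2 fun n => measure_eq_zero_iff_ae_notMem.1 (htie (σ n) (hσ n))]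
      with u hu huL
    by_contra hne
    have hd0 : 0 < nndist u y := by
      refine pos_iff_ne_zero.2 fun hz => hne ?_
      simp [hz, h0]
    obtain ⟨n, hn⟩ := (hσlim.eventually_lt_const hd0).exists
    exact hu n ⟨huL, hn.le⟩
  rw [hzero] at key
  simp only [nonpos_iff_eq_zero, ENNReal.coe_eq_zero] at key
  exact (hω.2 t ht0).ne' key

end Convexity

end PlanEstimate

theorem theorem1p2 {X : Type*} [MetricSpace X] [CompleteSpace X] [MeasurableSpace X]
    [BorelSpace X] (h : ℝ≥0 → ℝ≥0) (h_mono : Monotone h) (h_cont : Continuous h)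
    (h_pos : ∀ t, 0 < t → 0 < h t)
    (μ : Measure X) [IsProbabilityMeasure μ] (hμ : μ μ.supportᶜ = 0) :
    (h 0 = 0 → (PlanEstimate.SupportCondition h μ ↔ PlanEstimate.PlanCondition h μ)) ∧
    (PlanEstimate.SupportCondition h μ →
      (∃ ρ : ℝ≥0 → ℝ≥0, ρ 0 = 0 ∧ PlanEstimate.IsModulus ρ ∧
        PlanEstimate.UniformlyCyclicallyConvex h ρ μ.support) ∧
      ∀ ρ : ℝ≥0 → ℝ≥0, ρ 0 = 0 → (∀ t, 0 < t → 0 < ρ t) →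
        PlanEstimate.UniformlyCyclicallyConvex h ρ μ.support →
        PlanEstimate.EstimateHolds h μ (PlanEstimate.explicitModulus h μ ρ) ∧
        (∀ t, 0 < t → 0 < PlanEstimate.explicitModulus h μ ρ t) ∧
        (Monotone ρ → Monotone (PlanEstimate.explicitModulus h μ ρ))) := by
  have hmodulus : PlanEstimate.SupportCondition h μ →
      (∃ ρ : ℝ≥0 → ℝ≥0, ρ 0 = 0 ∧ PlanEstimate.IsModulus ρ ∧
        PlanEstimate.UniformlyCyclicallyConvex h ρ μ.support) ∧
      ∀ ρ : ℝ≥0 → ℝ≥0, ρ 0 = 0 → (∀ t, 0 < t → 0 < ρ t) →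
        PlanEstimate.UniformlyCyclicallyConvex h ρ μ.support →
        PlanEstimate.EstimateHolds h μ (PlanEstimate.explicitModulus h μ ρ) ∧
        (∀ t, 0 < t → 0 < PlanEstimate.explicitModulus h μ ρ t) ∧
        (Monotone ρ → Monotone (PlanEstimate.explicitModulus h μ ρ)) := by
    rintro ⟨hS, hconv⟩
    refine ⟨PlanEstimate.exists_uniformlyCyclicallyConvex h_mono h_cont hS hconv,
      fun ρ hρ0 hρ hc => ⟨?_, fun t ht => ?_, fun hm s t hst => ?_⟩⟩
    · exact PlanEstimate.estimateHolds_explicitModulus h_mono h_cont hμ hS hρ0 hρ hc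
    · have : 0 < ρ t / 4 := div_pos (hρ t ht) (by norm_num)
      exact mul_pos (PlanEstimate.minBall_pos hμ hS this) (h_pos _ this)
    · have : ρ s / 4 ≤ ρ t / 4 := div_le_div_of_nonneg_right (hm hst) zero_le
      exact mul_le_mul' (PlanEstimate.minBall_mono hμ this) (h_mono this)
  refine ⟨fun h0 => ⟨fun hsupp => ?_, ?_⟩, hmodulus⟩
  · obtain ⟨⟨ρ, hρ0, hρ, hc⟩, H⟩ := hmodulus hsupp
    obtain ⟨h1, h2, h3⟩ := H ρ hρ0 hρ.2 hc
    exact ⟨_, ⟨h3 hρ.1, h2⟩, h1⟩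
  · rintro ⟨ω, hω, hest⟩
    exact ⟨hest.isCompact_support h_mono h_cont h0 hμ hω,
      hest.strictlyCyclicallyConvex h_cont h0 hμ hω⟩

end
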